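/- Let $\Omega\subset\mathbb R^2$ be a bounded Lipschitz domain and let $n\in L^\infty(\Omega)$ be real valued with $n\ge 1+\delta$ a.e. in $\Omega$ for some $\delta>0$. All function spaces are complex; $\|\cdot\|_s$ is the norm of $H^s(\Omega)$ (Sobolev–Slobodeckij norm for non-integer $s$), $H^k_0(\Omega)$ is the closure of $C_c^\infty(\Omega)$ in $H^k(\Omega)$, $(f,g)=\int_\Omega f\bar g\,dx$, and $(f,g)_{n-1}=\int_\Omega \frac1{n-1}f\bar g\,dx$. Put $\mathbf H=H^2_0(\Omega)\times H^1_0(\Omega)$ with $\|(u,w)\|_{\mathbf H}=\|u\|_2+\|w\|_1$, and $\mathbf H_1=H^1_0(\Omega)\times L^2(\Omega)$ with $\|(u,w)\|_{\mathbf H_1}=\|u\|_1+\|w\|_0$. For each grid of a family of grids of $\Omega$, with mesh size $h>0$, let $X_h\subset H^2_0(\Omega)$ and $Y_h\subset H^1_0(\Omega)$ be finite-dimensional subspaces, and $\mathbf H_h=X_h\times Y_h$. Let $k=1$ or $k=2$ (the degree of the bilinear, respectively biquadratic, Lagrange element used for $Y_h$), and let $r_1,r_2\in(0,1]$. Assume,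 with constants $C$ that do not depend on the grid or on the functions involved: (C1) For every $(\psi,\varphi)\in\mathbf H$, $\inf_{(v,z)\in\mathbf H_h}\|(\psi,\varphi)-(v,z)\|_{\mathbf H}\to0$ as $h\to0$. (C2) For every $\sigma_1\in(0,2]$, $s\in\{1,2\}$ and $\psi\in H^2_0(\Omega)\cap H^{2+\sigma_1}(\Omega)$, $\inf_{v\in X_h}\|\psi-v\|_s\le C h^{2+\sigma_1-s}\|\psi\|_{2+\sigma_1}$; for every $\sigma_2\in(0,k]$, $t\in\{0,1\}$ and $\varphi\in H^1_0(\Omega)\cap H^{1+\sigma_2}(\Omega)$, $\inf_{z\in Y_h}\|\varphi-z\|_t\le C h^{1+\sigma_2-t}\|\varphi\|_{1+\sigma_2}$. (Here $C$ may depend on $\sigma_1$, $\sigma_2$.) (A1) For every $\xi\in H^{-1}(\Omega)$ there is a weak solution $\psi\in H^2_0(\Omega)\cap H^{2+r_1}(\Omega)$ of $\Delta\big(\frac1{n-1}\Delta\psi\big)=\xi$ in $\Omega$, $\psi=\partial\psi/\partial\nu=0$ on $\partial\Omega$, that is $(\Delta\psi,\Delta v)_{n-1}=(\xi,v)$ for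 all $v\in H^2_0(\Omega)$, with $\|\psi\|_{2+r_1}\le C\|\xi\|_{-1}$, where $\|\xi\|_{-1}=\sup_{0\ne v\in H^1_0(\Omega)}|(\xi,v)|/\|v\|_1$. (A2) For every $f\in L^2(\Omega)$ there is a weak solution $\varphi\in H^1_0(\Omega)\cap H^{1+r_2}(\Omega)$ of $\Delta\varphi=f$ in $\Omega$, $\varphi=0$ on $\partial\Omega$, that is $-(\nabla\varphi,\nabla z)=(f,z)$ for all $z\in H^1_0(\Omega)$, with $\|\varphi\|_{1+r_2}\le C\|f\|_0$. Then for every grid and every $(u,w)\in\mathbf H$ there is a unique $P_h(u,w)=(P_h^1u,P_h^2w)\in\mathbf H_h$ (the Ritz projection) with $(\Delta(u-P_h^1u),\Delta v)_{n-1}=0$ for all $v\in X_h$ and $(\nabla(w-P_h^2w),\nabla z)=0$ for all $z\in Y_h$; and there is a constant $C>0$, independent of the grid and of $(u,w)$, such that for every grid and all $(u,w)\in\mathbf H$ $$\|(u,w)-P_h(u,w)\|_{\mathbf H_1}\le C\,h^{r}\,\|(u,w)-P_h(u,w)\|_{\mathbf H},\qquad r=\min\{r_1,r_2\}.$$ 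-/

import Mathlib

open MeasureTheory Filter Topology
open scoped ENNReal ContDiff

noncomputable section

namespace Transmission

/-- The Euclidean plane `ℝ²`. -/
abbrev Plane : Type := EuclideanSpace ℝ (Fin 2)

/-- The complex space `L²(Ω)`. -/
abbrev L2 (Ω : Set Plane) : Type := Lp ℂ 2 (volume.restrict Ω)

/-- `Ω` is a bounded Lipschitz domain: nonempty, open, connected, bounded, and near each of its
boundary points it is, in suitable Cartesian coordinates, the region strictly above the graph of a
Lipschitz function. -/
structure IsBoundedLipschitzDomain (Ω : Set Plane) : Prop where
  isOpen : IsOpen Ω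
  isConnected : IsConnected Ω
  isBounded : Bornology.IsBounded Ω
  lipschitz : ∀ p ∈ frontier Ω, ∃ ρ > 0, ∃ e : Plane ≃ᵃⁱ[ℝ] Plane, ∃ K, ∃ γ : ℝ → ℝ,
    LipschitzWith K γ ∧
      ∀ x ∈ Metric.ball p ρ, (x ∈ Ω ↔ γ (e x 0) < e x 1)

/-- `η ∈ C_c^∞(Ω)`, complex valued. -/
structure IsTest (Ω : Set Plane) (η : Plane → ℂ) : Prop where
  smooth : ContDiff ℝ ∞ η
  compact : HasCompactSupport η
  support : tsupport η ⊆ Ω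

/-- The classical partial derivative `∂ᵢ η`. -/
def partialD (i : Fin 2) (η : Plane → ℂ) : Plane → ℂ :=
  fun x => fderiv ℝ η x (EuclideanSpace.single i 1)

/-- The classical derivative `∂^α η = ∂₁^{α₁} ∂₂^{α₂} η`, for a multi-index `α = (α₁, α₂)`. -/
def classicalD (α : ℕ × ℕ) (η : Plane → ℂ) : Plane → ℂ :=
  (partialD 0)^[α.1] ((partialD 1)^[α.2] η)

/-- `g ∈ L²(Ω)` is the weak derivative `∂^α u` of `u ∈ L²(Ω)`. -/
def IsWeakDeriv (Ω : Set Plane) (α : ℕ × ℕ) (u g : L2 Ω) : Prop :=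
  ∀ η, IsTest Ω η →
    ∫ x in Ω, u x * classicalD α η x = (-1) ^ (α.1 + α.2) * ∫ x in Ω, g x * η x

open Classical in
/-- The weak derivative `∂^α u ∈ L²(Ω)` (zero if there is none). -/
def weakD {Ω : Set Plane} (α : ℕ × ℕ) (u : L2 Ω) : L2 Ω :=
  if hu : ∃ g, IsWeakDeriv Ω α u g then hu.choose else 0

/-- The weak Laplacian `Δu = ∂₁²u + ∂₂²u` of `u ∈ H²(Ω)`. -/
def lap {Ω : Set Plane} (u : L2 Ω) : L2 Ω := weakD (2, 0) u + weakD (0, 2) u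

/-! ### Sobolev spaces and norms -/

/-- `u ∈ H^k(Ω)` for an integer `k ≥ 0`. -/
def MemH (k : ℕ) {Ω : Set Plane} (u : L2 Ω) : Prop :=
  ∀ α : ℕ × ℕ, α.1 + α.2 ≤ k → ∃ g, IsWeakDeriv Ω α u g

/-- The norm `‖u‖_k = (∑_{|α| ≤ k} ‖∂^α u‖²)^{1/2}` of `H^k(Ω)`, for an integer `k ≥ 0`. -/
def hNorm (k : ℕ) {Ω : Set Plane} (u : L2 Ω) : ℝ :=
  √(∑ j ∈ Finset.range (k + 1), ∑ α ∈ Finset.HasAntidiagonal.antidiagonal j, ‖weakD α u‖ ^ 2)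

/-- The square of the Sobolev–Slobodeckij seminorm of order `θ ∈ (0,1)`,
`∫_Ω ∫_Ω |u(x) - u(y)|² / |x - y|^{2 + 2θ} dx dy`. -/
def slobodeckijSq (θ : ℝ) {Ω : Set Plane} (u : L2 Ω) : ℝ≥0∞ :=
  ∫⁻ x in Ω, ∫⁻ y in Ω, ENNReal.ofReal (‖u x - u y‖ ^ 2 / ‖x - y‖ ^ (2 + 2 * θ))

/-- `u ∈ H^s(Ω)` for a real `s ≥ 0`: `u ∈ H^k(Ω)` with `k = ⌊s⌋` and, if `θ = s - k > 0`, the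
derivatives of order `k` have finite Slobodeckij seminorm of order `θ`. -/
def MemHs (s : ℝ) {Ω : Set Plane} (u : L2 Ω) : Prop :=
  MemH ⌊s⌋₊ u ∧
    (s - ⌊s⌋₊ ≠ 0 →
      ∀ α ∈ Finset.HasAntidiagonal.antidiagonal ⌊s⌋₊, slobodeckijSq (s - ⌊s⌋₊) (weakD α u) < ⊤)

/-- The norm `‖u‖_s` of `H^s(Ω)` for a real `s ≥ 0`. -/
def hsNorm (s : ℝ) {Ω : Set Plane} (u : L2 Ω) : ℝ :=
  √(hNorm ⌊s⌋₊ u ^ 2 +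
    if s - ⌊s⌋₊ = 0 then 0
    else ∑ α ∈ Finset.HasAntidiagonal.antidiagonal ⌊s⌋₊, (slobodeckijSq (s - ⌊s⌋₊) (weakD α u)).toReal)

theorem IsTest.partialD {Ω : Set Plane} {η : Plane → ℂ} (hη : IsTest Ω η) (i : Fin 2) :
    IsTest Ω (partialD i η) where
  smooth := (hη.smooth.fderiv_right (m := ∞) (by simp)).clm_apply contDiff_const
  compact := hη.compact.fderiv_apply (𝕜 := ℝ) _
  support := (tsupport_fderiv_apply_subset ℝ _).trans hη.support

theorem IsTest.iterate {Ω : Set Plane} (i : Fin 2) (m : ℕ) {η : Plane → ℂ} (hη : IsTest Ω η) :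
    IsTest Ω ((Transmission.partialD i)^[m] η) := by
  induction m generalizing η with
  | zero => exact hη
  | succ m ih => exact ih (hη.partialD i)

theorem IsTest.classicalD {Ω : Set Plane} {η : Plane → ℂ} (hη : IsTest Ω η) (α : ℕ × ℕ) :
    IsTest Ω (classicalD α η) :=
  (hη.iterate 1 α.2).iterate 0 α.1

theorem IsTest.memLp {Ω : Set Plane} {η : Plane → ℂ} (hη : IsTest Ω η) :
    MemLp η 2 (volume.restrict Ω) :=
  (hη.smooth.continuous.memLp_of_hasCompactSupport hη.compact).restrict Ω

theorem IsTest.integrable_mul {Ω : Set Plane} {η : Plane → ℂ} (hη : IsTest Ω η) (u : L2 Ω) :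
    Integrable (fun x => u x * η x) (volume.restrict Ω) :=
  (Lp.memLp u).integrable_mul hη.memLp

theorem IsTest.zero (Ω : Set Plane) : IsTest Ω 0 where
  smooth := contDiff_const
  compact := HasCompactSupport.zero
  support := by simp [tsupport]

theorem IsTest.add {Ω : Set Plane} {η ζ : Plane → ℂ} (hη : IsTest Ω η) (hζ : IsTest Ω ζ) :
    IsTest Ω (η + ζ) where
  smooth := hη.smooth.add hζ.smooth
  compact := hη.compact.add hζ.compact
  support := (tsupport_add η ζ).trans (Set.union_subset hη.support hζ.support)

theorem IsTest.smul {Ω : Set Plane} {η : Plane → ℂ} (c : ℂ) (hη : IsTest Ω η) :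
    IsTest Ω (c • η) where
  smooth := contDiff_const.smul hη.smooth
  compact := hη.compact.smul_left (f := fun _ => c)
  support := (tsupport_smul_subset_right (fun _ => c) η).trans hη.support

theorem partialD_add {Ω : Set Plane} (i : Fin 2) {η ζ : Plane → ℂ} (hη : IsTest Ω η)
    (hζ : IsTest Ω ζ) : partialD i (η + ζ) = partialD i η + partialD i ζ := by
  funext x
  simp [partialD, fderiv_add (hη.smooth.differentiable (by simp) x)
    (hζ.smooth.differentiable (by simp) x)]

theorem partialD_smul {Ω : Set Plane} (i : Fin 2) (c : ℂ) {η : Plane → ℂ} (hη : IsTest Ω η) :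
    partialD i (c • η) = c • partialD i η := by
  funext x
  simp [partialD, fderiv_const_smul (hη.smooth.differentiable (by simp) x)]

theorem iterate_add {Ω : Set Plane} (i : Fin 2) (m : ℕ) {η ζ : Plane → ℂ} (hη : IsTest Ω η)
    (hζ : IsTest Ω ζ) :
    (partialD i)^[m] (η + ζ) = (partialD i)^[m] η + (partialD i)^[m] ζ := by
  induction m generalizing η ζ with
  | zero => rfl
  | succ m ih =>
    simp only [Function.iterate_succ_apply, partialD_add i hη hζ]
    exact ih (hη.partialD i) (hζ.partialD i)

theorem iterate_smul {Ω : Set Plane} (i : Fin 2) (m : ℕ) (c : ℂ) {η : Plane → ℂ}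
    (hη : IsTest Ω η) : (partialD i)^[m] (c • η) = c • (partialD i)^[m] η := by
  induction m generalizing η with
  | zero => rfl
  | succ m ih =>
    simp only [Function.iterate_succ_apply, partialD_smul i c hη]
    exact ih (hη.partialD i)

theorem classicalD_add {Ω : Set Plane} (α : ℕ × ℕ) {η ζ : Plane → ℂ} (hη : IsTest Ω η)
    (hζ : IsTest Ω ζ) : classicalD α (η + ζ) = classicalD α η + classicalD α ζ := by
  simp only [classicalD, iterate_add 1 α.2 hη hζ,
    iterate_add 0 α.1 (hη.iterate 1 α.2) (hζ.iterate 1 α.2)]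

theorem classicalD_smul {Ω : Set Plane} (α : ℕ × ℕ) (c : ℂ) {η : Plane → ℂ}
    (hη : IsTest Ω η) : classicalD α (c • η) = c • classicalD α η := by
  simp only [classicalD, iterate_smul 1 α.2 c hη, iterate_smul 0 α.1 c (hη.iterate 1 α.2)]

theorem IsWeakDeriv.add {Ω : Set Plane} {α : ℕ × ℕ} {u v f g : L2 Ω}
    (hu : IsWeakDeriv Ω α u f) (hv : IsWeakDeriv Ω α v g) :
    IsWeakDeriv Ω α (u + v) (f + g) := by
  intro η hη
  have h1 : ∀ (a b : L2 Ω) {ζ : Plane → ℂ}, IsTest Ω ζ →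
      ∫ x in Ω, (a + b) x * ζ x = (∫ x in Ω, a x * ζ x) + ∫ x in Ω, b x * ζ x := by
    intro a b ζ hζ
    rw [← integral_add (hζ.integrable_mul a) (hζ.integrable_mul b)]
    refine integral_congr_ae ?_
    filter_upwards [Lp.coeFn_add a b] with x hx
    rw [hx, Pi.add_apply, add_mul]
  rw [h1 u v (hη.classicalD α), h1 f g hη, hu η hη, hv η hη, mul_add]

theorem IsWeakDeriv.smul {Ω : Set Plane} {α : ℕ × ℕ} {u f : L2 Ω} (c : ℂ)
    (hu : IsWeakDeriv Ω α u f) : IsWeakDeriv Ω α (c • u) (c • f) := by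
  intro η hη
  have h1 : ∀ (a : L2 Ω) (ζ : Plane → ℂ),
      ∫ x in Ω, (c • a) x * ζ x = c * ∫ x in Ω, a x * ζ x := by
    intro a ζ
    rw [← integral_const_mul]
    refine integral_congr_ae ?_
    filter_upwards [Lp.coeFn_smul c a] with x hx
    rw [hx, Pi.smul_apply, smul_eq_mul, mul_assoc]
  rw [h1, h1, hu η hη]
  ring

/-- `H₀^k(Ω)`: the closure of `C_c^∞(Ω)` in `H^k(Ω)`. It consists of the `u ∈ H^k(Ω)` for which
there are test functions `η_m` such that `∂^α η_m → ∂^α u` in `L²(Ω)` for all `|α| ≤ k`. -/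
def H0 (k : ℕ) (Ω : Set Plane) : Submodule ℂ (L2 Ω) where
  carrier := {u | ∃ η : ℕ → Plane → ℂ, (∀ m, IsTest Ω (η m)) ∧
    ∀ α : ℕ × ℕ, α.1 + α.2 ≤ k → ∃ g : L2 Ω, IsWeakDeriv Ω α u g ∧
      Tendsto (fun m => eLpNorm (fun x => g x - classicalD α (η m) x) 2 (volume.restrict Ω))
        atTop (𝓝 0)}
  zero_mem' := by
    refine ⟨fun _ => 0, fun _ => IsTest.zero Ω, fun α _ => ⟨0, ?_, ?_⟩⟩
    · intro η _
      have h0 : ∀ ζ : Plane → ℂ, ∫ x in Ω, (0 : L2 Ω) x * ζ x = 0 := by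
        intro ζ
        rw [integral_eq_zero_of_ae]
        filter_upwards [Lp.coeFn_zero ℂ 2 (volume.restrict Ω)] with x hx
        rw [hx, Pi.zero_apply, zero_mul]
      rw [h0, h0, mul_zero]
    · have h0 : classicalD α (0 : Plane → ℂ) = 0 := by
        have h := classicalD_smul α 0 (IsTest.zero Ω)
        simpa using h
      have h1 : eLpNorm (fun x => (0 : L2 Ω) x - classicalD α 0 x) 2
          (volume.restrict Ω) = 0 := by
        rw [← eLpNorm_zero (ε := ℂ) (p := 2) (μ := volume.restrict Ω)]
        refine eLpNorm_congr_ae ?_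
        filter_upwards [Lp.coeFn_zero ℂ 2 (volume.restrict Ω)] with x hx
        rw [hx, h0, Pi.zero_apply, sub_zero]
      simp only [h1]
      exact tendsto_const_nhds
  add_mem' := by
    rintro u v ⟨η, hη, hu⟩ ⟨ζ, hζ, hv⟩
    refine ⟨fun m => η m + ζ m, fun m => (hη m).add (hζ m), fun α hα => ?_⟩
    obtain ⟨f, hf, hf'⟩ := hu α hα
    obtain ⟨g, hg, hg'⟩ := hv α hα
    refine ⟨f + g, hf.add hg, ?_⟩
    have hs := hf'.add hg'
    rw [add_zero] at hs
    refine tendsto_of_tendsto_of_tendsto_of_le_of_le tendsto_const_nhds hs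
      (fun _ => zero_le) fun m => ?_
    refine le_trans (le_of_eq ?_) (eLpNorm_add_le
      ((Lp.aestronglyMeasurable f).sub ((hη m).classicalD α).memLp.aestronglyMeasurable)
      ((Lp.aestronglyMeasurable g).sub ((hζ m).classicalD α).memLp.aestronglyMeasurable)
      one_le_two)
    refine eLpNorm_congr_ae ?_
    filter_upwards [Lp.coeFn_add f g] with x hx
    simp only [hx, classicalD_add α (hη m) (hζ m), Pi.add_apply]
    ring
  smul_mem' := by
    rintro c u ⟨η, hη, hu⟩
    refine ⟨fun m => c • η m, fun m => (hη m).smul c, fun α hα => ?_⟩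
    obtain ⟨f, hf, hf'⟩ := hu α hα
    refine ⟨c • f, hf.smul c, ?_⟩
    have hs := ENNReal.Tendsto.const_mul (a := ‖c‖ₑ) hf' (Or.inr enorm_ne_top)
    rw [mul_zero] at hs
    refine hs.congr fun m => ?_
    rw [← eLpNorm_const_smul]
    refine eLpNorm_congr_ae ?_
    filter_upwards [Lp.coeFn_smul c f] with x hx
    simp only [hx, classicalD_smul α c (hη m), Pi.smul_apply, smul_eq_mul]
    ring

theorem H0_anti {k l : ℕ} (hkl : k ≤ l) (Ω : Set Plane) : H0 l Ω ≤ H0 k Ω := by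
  rintro u ⟨η, hη, hu⟩
  exact ⟨η, hη, fun α hα => hu α (hα.trans hkl)⟩

/-! ### The forms, the product norms and the Ritz projection -/

/-- The form `(f, g) = ∫_Ω f ḡ dx`. -/
def l2Form {Ω : Set Plane} (f g : L2 Ω) : ℂ :=
  ∫ x in Ω, f x * starRingEnd ℂ (g x)

/-- The form `(f, g)_{n-1} = ∫_Ω (n-1)⁻¹ f ḡ dx`. -/
def weightedForm (n : Plane → ℝ) {Ω : Set Plane} (f g : L2 Ω) : ℂ :=
  ∫ x in Ω, ((1 / (n x - 1) : ℝ) : ℂ) * f x * starRingEnd ℂ (g x)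

/-- The form `(∇w, ∇z)`. -/
def gradForm {Ω : Set Plane} (w z : L2 Ω) : ℂ :=
  l2Form (weakD (1, 0) w) (weakD (1, 0) z) + l2Form (weakD (0, 1) w) (weakD (0, 1) z)

/-- The norm `‖(u, w)‖_𝐇 = ‖u‖₂ + ‖w‖₁` of `𝐇 = H₀²(Ω) × H₀¹(Ω)`. -/
def normH {Ω : Set Plane} (p : L2 Ω × L2 Ω) : ℝ := hNorm 2 p.1 + hNorm 1 p.2

/-- The norm `‖(u, w)‖_{𝐇₁} = ‖u‖₁ + ‖w‖₀` of `𝐇₁ = H₀¹(Ω) × L²(Ω)`. -/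
def normH1 {Ω : Set Plane} (p : L2 Ω × L2 Ω) : ℝ := hNorm 1 p.1 + hNorm 0 p.2

/-- `p = (P_h¹ u, P_h² w)` is the Ritz projection of `q = (u, w)` on `X × Y`. -/
structure IsRitzProj (n : Plane → ℝ) {Ω : Set Plane} (X Y : Submodule ℂ (L2 Ω))
    (q p : L2 Ω × L2 Ω) : Prop where
  fst_mem : p.1 ∈ X
  snd_mem : p.2 ∈ Y
  fst_orth : ∀ v ∈ X, weightedForm n (lap (q.1 - p.1)) (lap v) = 0
  snd_orth : ∀ z ∈ Y, gradForm (q.2 - p.2) z = 0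

/-! ### The conditions

The finite element spaces `X i ⊂ H₀²(Ω)`, `Y i ⊂ H₀¹(Ω)` are indexed by the grids `i`, and `h i` is
the mesh size of the grid `i`. -/

/-- `n` is (essentially) bounded on `Ω`, and `1 + δ ≤ n` there for some `δ > 0`. -/
structure IsIndex (Ω : Set Plane) (n : Plane → ℝ) : Prop where
  aemeasurable : AEMeasurable n (volume.restrict Ω)
  lower : ∃ δ > 0, ∀ᵐ x ∂(volume.restrict Ω), 1 + δ ≤ n x
  upper : ∃ M, ∀ᵐ x ∂(volume.restrict Ω), n x ≤ M

/-- Condition (C1): the spaces `X i × Y i` approximate every element of `𝐇` as `h → 0`. -/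
def CondC1 {Ω : Set Plane} {ι : Type*} (h : ι → ℝ) (X Y : ι → Submodule ℂ (L2 Ω)) : Prop :=
  ∀ ψ ∈ H0 2 Ω, ∀ φ ∈ H0 1 Ω,
    Tendsto (fun i => ⨅ p : X i × Y i, normH (ψ - (p.1 : L2 Ω), φ - (p.2 : L2 Ω)))
      (comap h (𝓝[>] 0)) (𝓝 0)

/-- Condition (C2): the approximation orders of the spaces `X i` and `Y i`. Here `k` is the degree of
the element used for `Y i`: `k = 1` for the bilinear, `k = 2` for the biquadratic one. -/
structure CondC2 {Ω : Set Plane} {ι : Type*} (h : ι → ℝ) (X Y : ι → Submodule ℂ (L2 Ω))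
    (k : ℕ) : Prop where
  fst : ∀ σ : ℝ, 0 < σ → σ ≤ 2 → ∀ s : ℕ, s = 1 ∨ s = 2 → ∃ C : ℝ,
    ∀ i, ∀ ψ ∈ H0 2 Ω, MemHs (2 + σ) ψ →
      ⨅ v : X i, hNorm s (ψ - (v : L2 Ω)) ≤ C * h i ^ (2 + σ - s) * hsNorm (2 + σ) ψ
  snd : ∀ σ : ℝ, 0 < σ → σ ≤ k → ∀ t : ℕ, t = 0 ∨ t = 1 → ∃ C : ℝ,
    ∀ i, ∀ φ ∈ H0 1 Ω, MemHs (1 + σ) φ →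
      ⨅ z : Y i, hNorm t (φ - (z : L2 Ω)) ≤ C * h i ^ (1 + σ - t) * hsNorm (1 + σ) φ

/-- The antilinear functional `ξ` (`v ↦ (ξ, v)`) on `H₀¹(Ω)` is bounded, that is `ξ ∈ H⁻¹(Ω)`. -/
def MemHneg {Ω : Set Plane} (ξ : H0 1 Ω →ₛₗ[starRingEnd ℂ] ℂ) : Prop :=
  ∃ M : ℝ, ∀ v : H0 1 Ω, ‖ξ v‖ ≤ M * hNorm 1 (v : L2 Ω)

/-- The norm `‖ξ‖_{-1} = sup_{v ≠ 0} |(ξ, v)| / ‖v‖₁` (`v = 0` contributes `0 / 0 = 0`). -/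
def hnegNorm {Ω : Set Plane} (ξ : H0 1 Ω →ₛₗ[starRingEnd ℂ] ℂ) : ℝ :=
  ⨆ v : H0 1 Ω, ‖ξ v‖ / hNorm 1 (v : L2 Ω)

/-- Condition (A1): for all `ξ ∈ H⁻¹(Ω)` the clamped problem `Δ((n-1)⁻¹Δψ) = ξ` in `Ω`,
`ψ = ∂ψ/∂ν = 0` on `∂Ω`, has a (weak) solution `ψ ∈ H₀²(Ω) ∩ H^{2+r}(Ω)` with
`‖ψ‖_{2+r} ≤ C ‖ξ‖_{-1}`. -/
def CondA1 (Ω : Set Plane) (n : Plane → ℝ) (r : ℝ) : Prop :=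
  ∃ C : ℝ, ∀ ξ : H0 1 Ω →ₛₗ[starRingEnd ℂ] ℂ, MemHneg ξ →
    ∃ ψ ∈ H0 2 Ω, MemHs (2 + r) ψ ∧
      (∀ (v : L2 Ω) (hv : v ∈ H0 2 Ω),
        weightedForm n (lap ψ) (lap v) = ξ ⟨v, H0_anti one_le_two Ω hv⟩) ∧
      hsNorm (2 + r) ψ ≤ C * hnegNorm ξ

/-- Condition (A2): for all `f ∈ L²(Ω)` the Dirichlet problem `Δφ = f` in `Ω`, `φ = 0` on `∂Ω`,
has a (weak) solution `φ ∈ H₀¹(Ω) ∩ H^{1+r}(Ω)` with `‖φ‖_{1+r} ≤ C ‖f‖₀`. -/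
def CondA2 (Ω : Set Plane) (r : ℝ) : Prop :=
  ∃ C : ℝ, ∀ f : L2 Ω, ∃ φ ∈ H0 1 Ω, MemHs (1 + r) φ ∧
    (∀ z ∈ H0 1 Ω, -gradForm φ z = l2Form f z) ∧
    hsNorm (1 + r) φ ≤ C * ‖f‖

end Transmission

end

namespace Transmission

open scoped InnerProductSpace

/-! ### Weak derivatives as linear maps -/

/-! Both energy forms are pullbacks `⟪T v, T u⟫` of an `L²` inner product along a linear map: `T =
(n-1)^{-1/2} Δ` on `H₀²(Ω)` and `T = ∇` on `H₀¹(Ω)`. Once `T` is injective, the Ritz projection is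
the orthogonal projection of `T u` onto the finite-dimensional image of the discrete space, pulled
back by `T` (`existsUnique_galerkin`). Neither coercivity nor completeness of `H₀^k(Ω)` is needed.
Injectivity comes from a Poincaré-type argument and one integration by parts
(`eq_zero_of_weakD_eq_zero`, `eq_zero_of_lap_eq_zero`).

The estimate is the Aubin–Nitsche duality argument in each component. For an error `e` of the first
component, let `ψ` solve the clamped problem with right-hand side `v ↦ (e, v)_{H¹}`. Testing with
`e` and using Galerkin orthogonality gives `‖e‖₁² ≤ K² ‖e‖₂ inf_v ‖ψ - v‖₂`. By approximation and
regularity the infimum is at most a multiple of `h^{r₁} ‖e‖₁`, and one factor `‖e‖₁` cancels. For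
the second component the dual datum is `f = e` in `L²(Ω)`, and the infimum is taken in `‖·‖₁`.
Passing from `r₁`, `r₂` to their minimum is immediate for `h ≤ 1`; for larger `h` the weaker norm is
simply bounded by the stronger one. -/

theorem IsWeakDeriv.unique {Ω : Set Plane} (hΩ : IsOpen Ω) {α : ℕ × ℕ} {u f g : L2 Ω}
    (hf : IsWeakDeriv Ω α u f) (hg : IsWeakDeriv Ω α u g) : f = g := by
  have hloc : LocallyIntegrable (fun x => f x - g x) (volume.restrict Ω) :=
    ((Lp.memLp f).sub (Lp.memLp g)).locallyIntegrable one_le_two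
  -- The fundamental lemma of the calculus of variations: real-valued test functions already
  -- suffice, and they are embedded into the complex ones.
  have key := hΩ.ae_eq_zero_of_integral_contDiff_smul_eq_zero
    (μ := volume.restrict Ω) (hloc.locallyIntegrableOn Ω) (fun η h1 h2 h3 => by
      have hη : IsTest Ω (fun x => (η x : ℂ)) :=
        { smooth := Complex.ofRealCLM.contDiff.comp h1
          compact := h2.comp_left (g := fun t : ℝ => (t : ℂ)) Complex.ofReal_zero
          support := (closure_mono
            (Function.support_comp_subset (g := fun t : ℝ => (t : ℂ)) Complex.ofReal_zero η)).trans h3 }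
      have h4 : ∫ x in Ω, f x * (η x : ℂ) = ∫ x in Ω, g x * (η x : ℂ) :=
        mul_left_cancel₀ (pow_ne_zero _ (neg_ne_zero.mpr one_ne_zero))
          ((hf _ hη).symm.trans (hg _ hη))
      have h5 : ∀ x, η x • (f x - g x) = f x * (η x : ℂ) - g x * (η x : ℂ) := fun x => by
        rw [Complex.real_smul]; ring
      simp only [h5]
      rw [integral_sub (hη.integrable_mul f) (hη.integrable_mul g), h4, sub_self])
  refine Lp.ext ?_
  filter_upwards [key, ae_restrict_mem hΩ.measurableSet] with x hx hxΩ
  exact sub_eq_zero.mp (hx hxΩ)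

theorem isWeakDeriv_weakD {Ω : Set Plane} {α : ℕ × ℕ} {u : L2 Ω}
    (hu : ∃ g, IsWeakDeriv Ω α u g) : IsWeakDeriv Ω α u (weakD α u) := by
  rw [weakD, dif_pos hu]
  exact hu.choose_spec

theorem IsWeakDeriv.weakD_eq {Ω : Set Plane} (hΩ : IsOpen Ω) {α : ℕ × ℕ} {u g : L2 Ω}
    (hg : IsWeakDeriv Ω α u g) : weakD α u = g :=
  (isWeakDeriv_weakD ⟨g, hg⟩).unique hΩ hg

theorem weakD_zero {Ω : Set Plane} (hΩ : IsOpen Ω) (u : L2 Ω) : weakD (0, 0) u = u :=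
  IsWeakDeriv.weakD_eq hΩ fun η _ => by simp [classicalD]

theorem memH_of_mem_H0 {Ω : Set Plane} {k : ℕ} {u : L2 Ω} (hu : u ∈ H0 k Ω) : MemH k u := by
  obtain ⟨η, -, h⟩ := hu
  exact fun α hα => (h α hα).imp fun g hg => hg.1

/-- The weak derivative `∂^α`, as a linear map on `H₀^k(Ω)`. -/
noncomputable def weakDₗ {Ω : Set Plane} (hΩ : IsOpen Ω) {k : ℕ} (α : ℕ × ℕ)
    (hα : α.1 + α.2 ≤ k) : H0 k Ω →ₗ[ℂ] L2 Ω where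
  toFun u := weakD α (u : L2 Ω)
  map_add' u v := IsWeakDeriv.weakD_eq hΩ <|
    (isWeakDeriv_weakD (memH_of_mem_H0 u.2 α hα)).add
      (isWeakDeriv_weakD (memH_of_mem_H0 v.2 α hα))
  map_smul' c u := IsWeakDeriv.weakD_eq hΩ <|
    (isWeakDeriv_weakD (memH_of_mem_H0 u.2 α hα)).smul c

@[simp]
theorem weakDₗ_apply {Ω : Set Plane} (hΩ : IsOpen Ω) {k : ℕ} (α : ℕ × ℕ)
    (hα : α.1 + α.2 ≤ k) (u : H0 k Ω) : weakDₗ hΩ α hα u = weakD α (u : L2 Ω) := rfl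

/-! ### Sobolev norms of integer order -/

theorem hNorm_nonneg (k : ℕ) {Ω : Set Plane} (u : L2 Ω) : 0 ≤ hNorm k u := Real.sqrt_nonneg _

theorem hsNorm_nonneg (s : ℝ) {Ω : Set Plane} (u : L2 Ω) : 0 ≤ hsNorm s u := Real.sqrt_nonneg _

theorem norm_weakD_le_hNorm {k : ℕ} {α : ℕ × ℕ} (hα : α.1 + α.2 ≤ k) {Ω : Set Plane}
    (u : L2 Ω) : ‖weakD α u‖ ≤ hNorm k u := by
  refine Real.le_sqrt_of_sq_le ?_
  refine le_trans ?_ (Finset.single_le_sum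
    (f := fun j => ∑ α ∈ Finset.HasAntidiagonal.antidiagonal j, ‖weakD α u‖ ^ 2)
    (fun j _ => Finset.sum_nonneg fun _ _ => sq_nonneg _)
    (Finset.mem_range.mpr (Nat.lt_succ_of_le hα)))
  exact Finset.single_le_sum (f := fun α => ‖weakD α u‖ ^ 2) (fun _ _ => sq_nonneg _)
    (Finset.HasAntidiagonal.mem_antidiagonal.mpr rfl)

theorem hNorm_mono {k l : ℕ} (hkl : k ≤ l) {Ω : Set Plane} (u : L2 Ω) :
    hNorm k u ≤ hNorm l u :=
  Real.sqrt_le_sqrt <| Finset.sum_le_sum_of_subset_of_nonneg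
    (Finset.range_mono (Nat.succ_le_succ hkl))
    fun _ _ _ => Finset.sum_nonneg fun _ _ => sq_nonneg _

theorem hNorm_zero {Ω : Set Plane} (hΩ : IsOpen Ω) (u : L2 Ω) : hNorm 0 u = ‖u‖ := by
  simp [hNorm, weakD_zero hΩ]

theorem hNorm_one_sq {Ω : Set Plane} (hΩ : IsOpen Ω) (u : L2 Ω) :
    hNorm 1 u ^ 2 = ‖u‖ ^ 2 + ‖weakD (1, 0) u‖ ^ 2 + ‖weakD (0, 1) u‖ ^ 2 := by
  rw [hNorm, Real.sq_sqrt
    (Finset.sum_nonneg fun _ _ => Finset.sum_nonneg fun _ _ => sq_nonneg _)]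
  simp [Finset.sum_range_succ, Finset.Nat.antidiagonal_succ, weakD_zero hΩ]
  ring

theorem norm_lap_le {Ω : Set Plane} (u : L2 Ω) : ‖lap u‖ ≤ 2 * hNorm 2 u := by
  have h1 := norm_weakD_le_hNorm (k := 2) (α := (2, 0)) le_rfl u
  have h2 := norm_weakD_le_hNorm (k := 2) (α := (0, 2)) le_rfl u
  exact (norm_add_le _ _).trans (by linarith)

/-! ### Test functions -/

theorem IsTest.conj {Ω : Set Plane} {η : Plane → ℂ} (hη : IsTest Ω η) :
    IsTest Ω (fun x => starRingEnd ℂ (η x)) where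
  smooth := Complex.conjCLE.contDiff.comp hη.smooth
  compact := hη.compact.comp_left (map_zero _)
  support := (closure_mono (Function.support_comp_subset (map_zero _) η)).trans hη.support

theorem IsTest.coord_mul {Ω : Set Plane} {η : Plane → ℂ} (hη : IsTest Ω η) :
    IsTest Ω (fun x => ((x 0 : ℝ) : ℂ) * η x) where
  smooth := (Complex.ofRealCLM.contDiff.comp
    (EuclideanSpace.proj (𝕜 := ℝ) (0 : Fin 2)).contDiff).mul hη.smooth
  compact := hη.compact.mul_left
  support := (tsupport_mul_subset_right).trans hη.support

theorem partialD_conj (i : Fin 2) (η : Plane → ℂ) :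
    partialD i (fun x => starRingEnd ℂ (η x)) = fun x => starRingEnd ℂ (partialD i η x) := by
  funext x
  have h := Complex.conjCLE.comp_fderiv (f := η) (x := x)
  have h' : fderiv ℝ (fun x => starRingEnd ℂ (η x)) x
      = (Complex.conjCLE : ℂ →L[ℝ] ℂ).comp (fderiv ℝ η x) := h
  simp [partialD, h']

theorem iterate_partialD_conj (i : Fin 2) (m : ℕ) (η : Plane → ℂ) :
    (partialD i)^[m] (fun x => starRingEnd ℂ (η x)) =
      fun x => starRingEnd ℂ ((partialD i)^[m] η x) := by
  induction m generalizing η with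
  | zero => rfl
  | succ m ih => simp only [Function.iterate_succ_apply, partialD_conj, ih]

theorem classicalD_conj (α : ℕ × ℕ) (η : Plane → ℂ) :
    classicalD α (fun x => starRingEnd ℂ (η x)) =
      fun x => starRingEnd ℂ (classicalD α η x) := by
  simp only [classicalD, iterate_partialD_conj]

theorem partialD_coord_mul {η : Plane → ℂ} (hη : Differentiable ℝ η) (x : Plane) :
    partialD 0 (fun x => ((x 0 : ℝ) : ℂ) * η x) x
      = η x + ((x 0 : ℝ) : ℂ) * partialD 0 η x := by
  have h1 : HasFDerivAt (fun x : Plane => ((x 0 : ℝ) : ℂ))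
      (Complex.ofRealCLM.comp (EuclideanSpace.proj (𝕜 := ℝ) (0 : Fin 2))) x :=
    (Complex.ofRealCLM.comp (EuclideanSpace.proj (𝕜 := ℝ) (0 : Fin 2))).hasFDerivAt
  have h2 := (h1.mul (hη x).hasFDerivAt).fderiv
  have h3 : (fun x : Plane => ((x 0 : ℝ) : ℂ)) * η = fun x => ((x 0 : ℝ) : ℂ) * η x := rfl
  simp [partialD, ← h3, h2]
  ring

/-- A test function as an element of `L²(Ω)`. -/
noncomputable def IsTest.toL2 {Ω : Set Plane} {η : Plane → ℂ} (hη : IsTest Ω η) : L2 Ω :=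
  hη.memLp.toLp η

theorem IsTest.coeFn_toL2 {Ω : Set Plane} {η : Plane → ℂ} (hη : IsTest Ω η) :
    hη.toL2 =ᵐ[volume.restrict Ω] η :=
  hη.memLp.coeFn_toLp

theorem IsTest.inner_toL2 {Ω : Set Plane} {η : Plane → ℂ} (hη : IsTest Ω η) (u : L2 Ω) :
    ⟪hη.toL2, u⟫_ℂ = ∫ x in Ω, u x * starRingEnd ℂ (η x) := by
  rw [L2.inner_def]
  refine integral_congr_ae ?_
  filter_upwards [hη.coeFn_toL2] with x hx
  rw [hx, RCLike.inner_apply]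

/-- Weak derivatives are tested without conjugation, whereas the inner product conjugates; testing
with `η̄` reconciles the two. -/
theorem IsWeakDeriv.inner_classicalD {Ω : Set Plane} {α : ℕ × ℕ} {u g : L2 Ω}
    (hu : IsWeakDeriv Ω α u g) {η : Plane → ℂ} (hη : IsTest Ω η) :
    ⟪(hη.classicalD α).toL2, u⟫_ℂ = (-1) ^ (α.1 + α.2) * ⟪hη.toL2, g⟫_ℂ := by
  rw [IsTest.inner_toL2, IsTest.inner_toL2, ← hu _ hη.conj, classicalD_conj]

/-- Uniqueness of weak derivatives identifies the limits in the definition of `H0`, given separately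
for each `α`, with `weakD α u`. -/
theorem exists_tendsto_toL2 {Ω : Set Plane} (hΩ : IsOpen Ω) {k : ℕ} {u : L2 Ω}
    (hu : u ∈ H0 k Ω) : ∃ η : ℕ → Plane → ℂ, ∃ hη : ∀ m, IsTest Ω (η m),
      ∀ α : ℕ × ℕ, α.1 + α.2 ≤ k →
        Tendsto (fun m => ((hη m).classicalD α).toL2) atTop (𝓝 (weakD α u)) := by
  obtain ⟨η, hη, h⟩ := hu
  refine ⟨η, hη, fun α hα => ?_⟩
  obtain ⟨g, hg, hlim⟩ := h α hα
  rw [hg.weakD_eq hΩ, Lp.tendsto_Lp_iff_tendsto_eLpNorm']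
  refine hlim.congr fun m => ?_
  rw [← eLpNorm_neg]
  refine eLpNorm_congr_ae ?_
  filter_upwards [((hη m).classicalD α).coeFn_toL2] with x hx
  simp [hx]

/-! ### Injectivity of the gradient and of the Laplacian -/

/-- Poincaré's trick. With `η_m → u` and `x₁` the first coordinate, testing `∂₁u = 0` against `x₁
η_m` gives `⟪η_m, u⟫ = -⟪x₁ ∂₁η_m, u⟫`. Since `x₁` is bounded on `Ω` and `∂₁η_m → ∂₁u = 0`, the
right side tends to zero, while the left side tends to `‖u‖²`. -/
theorem eq_zero_of_weakD_eq_zero {Ω : Set Plane} (hΩ : IsOpen Ω) (hb : Bornology.IsBounded Ω)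
    {u : L2 Ω} (hu : u ∈ H0 1 Ω) (h0 : weakD (1, 0) u = 0) : u = 0 := by
  obtain ⟨R, hR⟩ := hb.exists_norm_le
  obtain ⟨η, hη, hlim⟩ := exists_tendsto_toL2 hΩ hu
  have hd := isWeakDeriv_weakD (memH_of_mem_H0 hu (1, 0) le_rfl)
  rw [h0] at hd
  have hη0 : Tendsto (fun m => (hη m).toL2) atTop (𝓝 u) := by
    have := hlim (0, 0) (Nat.zero_le _)
    rwa [weakD_zero hΩ] at this
  have hη1 : Tendsto (fun m => ((hη m).classicalD (1, 0)).toL2) atTop (𝓝 0) := by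
    rw [← h0]; exact hlim (1, 0) le_rfl
  have hbound : ∀ m, ‖⟪(hη m).toL2, u⟫_ℂ‖ ≤ R * ‖((hη m).classicalD (1, 0)).toL2‖ * ‖u‖ := by
    intro m
    have h1 := hd.inner_classicalD (hη m).coord_mul
    have h2 : ((hη m).coord_mul.classicalD (1, 0)).toL2
        = (hη m).toL2 + ((hη m).classicalD (1, 0)).coord_mul.toL2 := by
      refine Lp.ext ?_
      filter_upwards [((hη m).coord_mul.classicalD (1, 0)).coeFn_toL2, (hη m).coeFn_toL2,
        ((hη m).classicalD (1, 0)).coord_mul.coeFn_toL2,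
        Lp.coeFn_add (hη m).toL2 ((hη m).classicalD (1, 0)).coord_mul.toL2] with x a1 a2 a3 a4
      rw [a1, a4, Pi.add_apply, a2, a3]
      exact partialD_coord_mul ((hη m).smooth.differentiable (by simp)) x
    rw [h2, inner_add_left, inner_zero_right, mul_zero] at h1
    rw [eq_neg_of_add_eq_zero_left h1, norm_neg]
    refine (norm_inner_le_norm _ _).trans (mul_le_mul_of_nonneg_right ?_ (norm_nonneg _))
    refine Lp.norm_le_mul_norm_of_ae_le_mul ?_
    filter_upwards [((hη m).classicalD (1, 0)).coeFn_toL2,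
      ((hη m).classicalD (1, 0)).coord_mul.coeFn_toL2,
      ae_restrict_mem hΩ.measurableSet] with x a1 a2 a3
    rw [a1, a2, norm_mul, Complex.norm_real]
    exact mul_le_mul_of_nonneg_right ((PiLp.norm_apply_le x 0).trans (hR x a3)) (norm_nonneg _)
  have hl : Tendsto (fun m => ‖⟪(hη m).toL2, u⟫_ℂ‖) atTop (𝓝 ‖⟪u, u⟫_ℂ‖) :=
    (hη0.inner tendsto_const_nhds).norm
  have hr : Tendsto (fun m => R * ‖((hη m).classicalD (1, 0)).toL2‖ * ‖u‖) atTop (𝓝 0) := by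
    simpa using (hη1.norm.const_mul R).mul_const ‖u‖
  have := le_of_tendsto_of_tendsto' hl hr hbound
  exact inner_self_eq_zero.mp (norm_le_zero_iff.mp this)

/-- Integration by parts, `‖∇u‖² = -⟪u, Δu⟫ = 0`, carried out with test functions approximating `u`
in the left slot. -/
theorem eq_zero_of_lap_eq_zero {Ω : Set Plane} (hΩ : IsOpen Ω) (hb : Bornology.IsBounded Ω)
    {u : L2 Ω} (hu : u ∈ H0 2 Ω) (h0 : lap u = 0) : u = 0 := by
  refine eq_zero_of_weakD_eq_zero hΩ hb (H0_anti one_le_two Ω hu) ?_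
  obtain ⟨η, hη, hlim⟩ := exists_tendsto_toL2 hΩ hu
  have hd := fun α hα => isWeakDeriv_weakD (memH_of_mem_H0 hu α hα)
  -- Both the gradient terms and the Laplacian term are compared with `u` paired against second
  -- derivatives of `η_m`, so `weakD (1, 0) u` itself never has to be differentiated.
  have key : ∀ m, ⟪((hη m).classicalD (1, 0)).toL2, weakD (1, 0) u⟫_ℂ
      + ⟪((hη m).classicalD (0, 1)).toL2, weakD (0, 1) u⟫_ℂ = 0 := by
    intro m
    have a1 := (hd (1, 0) one_le_two).inner_classicalD ((hη m).classicalD (1, 0))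
    have a2 := (hd (0, 1) one_le_two).inner_classicalD ((hη m).classicalD (0, 1))
    have b1 := (hd (2, 0) le_rfl).inner_classicalD (hη m)
    have b2 := (hd (0, 2) le_rfl).inner_classicalD (hη m)
    have c1 : ⟪(((hη m).classicalD (1, 0)).classicalD (1, 0)).toL2, u⟫_ℂ
        = ⟪((hη m).classicalD (2, 0)).toL2, u⟫_ℂ := rfl
    have c2 : ⟪(((hη m).classicalD (0, 1)).classicalD (0, 1)).toL2, u⟫_ℂ
        = ⟪((hη m).classicalD (0, 2)).toL2, u⟫_ℂ := rfl
    have h3 : ⟪(hη m).toL2, weakD (2, 0) u⟫_ℂ + ⟪(hη m).toL2, weakD (0, 2) u⟫_ℂ = 0 := by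
      rw [← inner_add_right, ← lap, h0, inner_zero_right]
    norm_num at a1 a2 b1 b2
    linear_combination a1 + a2 - c1 - c2 - b1 - b2 - h3
  have hl := ((hlim (1, 0) one_le_two).inner
    (tendsto_const_nhds (x := weakD (1, 0) u)) (𝕜 := ℂ)).add
    ((hlim (0, 1) one_le_two).inner (tendsto_const_nhds (x := weakD (0, 1) u)) (𝕜 := ℂ))
  simp only [key] at hl
  have h := tendsto_nhds_unique hl tendsto_const_nhds
  rw [inner_self_eq_norm_sq_to_K, inner_self_eq_norm_sq_to_K] at h
  have h' : ‖weakD (1, 0) u‖ ^ 2 + ‖weakD (0, 1) u‖ ^ 2 = 0 :=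
    (RCLike.ofReal_eq_zero (K := ℂ)).mp (by push_cast; exact h)
  have h1 : ‖weakD (1, 0) u‖ ^ 2 = 0 := by nlinarith [sq_nonneg ‖weakD (0, 1) u‖]
  exact norm_eq_zero.mp (pow_eq_zero_iff two_ne_zero |>.mp h1)

/-! ### The sesquilinear forms as inner products -/

theorem inner_eq_l2Form {Ω : Set Plane} (f g : L2 Ω) : ⟪g, f⟫_ℂ = l2Form f g := by
  rw [L2.inner_def, l2Form]
  simp only [RCLike.inner_apply]

/-- The gradient, as a linear map on `H₀¹(Ω)`. -/
noncomputable def gradₗ {Ω : Set Plane} (hΩ : IsOpen Ω) :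
    H0 1 Ω →ₗ[ℂ] WithLp 2 (L2 Ω × L2 Ω) :=
  (WithLp.linearEquiv 2 ℂ (L2 Ω × L2 Ω)).symm.toLinearMap ∘ₗ
    (weakDₗ hΩ (1, 0) le_rfl).prod (weakDₗ hΩ (0, 1) le_rfl)

theorem inner_gradₗ {Ω : Set Plane} (hΩ : IsOpen Ω) (w z : H0 1 Ω) :
    ⟪gradₗ hΩ z, gradₗ hΩ w⟫_ℂ = gradForm (w : L2 Ω) (z : L2 Ω) := by
  rw [WithLp.prod_inner_apply, gradForm, ← inner_eq_l2Form, ← inner_eq_l2Form]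
  rfl

theorem gradₗ_injective {Ω : Set Plane} (hΩ : IsOpen Ω) (hb : Bornology.IsBounded Ω) :
    Function.Injective (gradₗ hΩ) := by
  refine (injective_iff_map_eq_zero _).mpr fun u hu => Subtype.ext ?_
  exact eq_zero_of_weakD_eq_zero hΩ hb u.2 (congrArg (fun p => p.fst) hu)

theorem norm_gradₗ_le {Ω : Set Plane} (hΩ : IsOpen Ω) (u : H0 1 Ω) :
    ‖gradₗ hΩ u‖ ≤ hNorm 1 (u : L2 Ω) := by
  refine abs_le_of_sq_le_sq' ?_ (hNorm_nonneg 1 _) |>.2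
  rw [WithLp.prod_norm_sq_eq_of_L2, hNorm_one_sq hΩ]
  change ‖weakD (1, 0) (u : L2 Ω)‖ ^ 2 + ‖weakD (0, 1) (u : L2 Ω)‖ ^ 2 ≤ _
  linarith [sq_nonneg ‖(u : L2 Ω)‖]

/-- The function `(n - 1)^{-1/2}`. -/
noncomputable def sqrtWeight (n : Plane → ℝ) (x : Plane) : ℂ := (√(1 / (n x - 1)) : ℝ)

theorem IsIndex.memLp_sqrtWeight {Ω : Set Plane} {n : Plane → ℝ} (hn : IsIndex Ω n) :
    MemLp (sqrtWeight n) ∞ (volume.restrict Ω) := by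
  obtain ⟨δ, hδ, hle⟩ := hn.lower
  have hm : AEMeasurable (sqrtWeight n) (volume.restrict Ω) :=
    Complex.measurable_ofReal.comp_aemeasurable
      (((hn.aemeasurable.sub_const 1).const_div 1).sqrt)
  refine memLp_top_of_bound hm.aestronglyMeasurable (√(1 / δ)) ?_
  filter_upwards [hle] with x hx
  rw [sqrtWeight, Complex.norm_real, Real.norm_of_nonneg (Real.sqrt_nonneg _)]
  exact Real.sqrt_le_sqrt (one_div_le_one_div_of_le hδ (by linarith))

/-- The operator `u ↦ (n - 1)^{-1/2} Δu` on `H₀²(Ω)`. -/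
noncomputable def weightedLapₗ {Ω : Set Plane} (hΩ : IsOpen Ω) {n : Plane → ℝ}
    (hn : IsIndex Ω n) : H0 2 Ω →ₗ[ℂ] L2 Ω where
  toFun u := hn.memLp_sqrtWeight.toLp _ • lap (u : L2 Ω)
  map_add' u v := by
    rw [← Lp.add_smul]
    congr 1
    exact map_add (weakDₗ hΩ (2, 0) le_rfl + weakDₗ hΩ (0, 2) le_rfl) u v
  map_smul' c u := by
    rw [RingHom.id_apply, Lp.smul_comm]
    congr 1
    exact map_smul (weakDₗ hΩ (2, 0) le_rfl + weakDₗ hΩ (0, 2) le_rfl) c u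

theorem coeFn_weightedLapₗ {Ω : Set Plane} (hΩ : IsOpen Ω) {n : Plane → ℝ}
    (hn : IsIndex Ω n) (u : H0 2 Ω) :
    weightedLapₗ hΩ hn u =ᵐ[volume.restrict Ω] fun x => sqrtWeight n x * lap (u : L2 Ω) x := by
  filter_upwards [Lp.coeFn_lpSMul (r := 2) (hn.memLp_sqrtWeight.toLp _) (lap (u : L2 Ω)),
    hn.memLp_sqrtWeight.coeFn_toLp] with x h1 h2
  refine h1.trans ?_
  rw [Pi.smul_apply', h2, smul_eq_mul]

theorem inner_weightedLapₗ {Ω : Set Plane} (hΩ : IsOpen Ω) {n : Plane → ℝ}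
    (hn : IsIndex Ω n) (u v : H0 2 Ω) :
    ⟪weightedLapₗ hΩ hn v, weightedLapₗ hΩ hn u⟫_ℂ
      = weightedForm n (lap (u : L2 Ω)) (lap (v : L2 Ω)) := by
  obtain ⟨δ, hδ, hle⟩ := hn.lower
  rw [L2.inner_def, weightedForm]
  refine integral_congr_ae ?_
  filter_upwards [coeFn_weightedLapₗ hΩ hn u, coeFn_weightedLapₗ hΩ hn v, hle] with x h1 h2 h3
  have h4 : (sqrtWeight n x) * (sqrtWeight n x) = ((1 / (n x - 1) : ℝ) : ℂ) := by
    rw [sqrtWeight, ← Complex.ofReal_mul,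
      Real.mul_self_sqrt (one_div_nonneg.mpr (by linarith))]
  have h5 : starRingEnd ℂ (sqrtWeight n x) = sqrtWeight n x := Complex.conj_ofReal _
  rw [h1, h2, RCLike.inner_apply, map_mul, h5, ← h4]
  ring

/-- The weight is nonzero a.e., so it can be cancelled and the Laplacian vanishes. -/
theorem weightedLapₗ_injective {Ω : Set Plane} (hΩ : IsOpen Ω) (hb : Bornology.IsBounded Ω)
    {n : Plane → ℝ} (hn : IsIndex Ω n) : Function.Injective (weightedLapₗ hΩ hn) := by
  obtain ⟨δ, hδ, hle⟩ := hn.lower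
  refine (injective_iff_map_eq_zero _).mpr fun u hu => Subtype.ext ?_
  refine eq_zero_of_lap_eq_zero hΩ hb u.2 (Lp.ext ?_)
  filter_upwards [coeFn_weightedLapₗ hΩ hn u, hle,
    Lp.coeFn_zero ℂ 2 (volume.restrict Ω)] with x h1 h2 h3
  rw [hu, h3] at h1
  rw [h3]
  refine (mul_eq_zero.mp h1.symm).resolve_left ?_
  exact Complex.ofReal_ne_zero.mpr (Real.sqrt_pos.mpr (one_div_pos.mpr (by linarith))).ne'

theorem exists_norm_weightedLapₗ_le {Ω : Set Plane} (hΩ : IsOpen Ω) {n : Plane → ℝ}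
    (hn : IsIndex Ω n) :
    ∃ K, 0 ≤ K ∧ ∀ u : H0 2 Ω, ‖weightedLapₗ hΩ hn u‖ ≤ K * hNorm 2 (u : L2 Ω) := by
  refine ⟨‖hn.memLp_sqrtWeight.toLp _‖ * 2, by positivity, fun u => ?_⟩
  refine (Lp.norm_smul_le _ _).trans ?_
  rw [mul_assoc]
  exact mul_le_mul_of_nonneg_left (norm_lap_le _) (norm_nonneg _)

/-! ### Abstract Galerkin orthogonality -/

/-- The image `T(V)` is finite-dimensional, hence admits an orthogonal projection; `p` is a preimage
in `V` of the projection of `T u`. Injectivity of `T` enters only in uniqueness, and `D` needs no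
norm. -/
theorem existsUnique_galerkin {D E : Type*} [AddCommGroup D] [Module ℂ D]
    [NormedAddCommGroup E] [InnerProductSpace ℂ E] (V : Submodule ℂ D) [FiniteDimensional ℂ V]
    {T : D →ₗ[ℂ] E} (hT : Function.Injective T) (u : D) :
    ∃! p, p ∈ V ∧ ∀ v ∈ V, ⟪T v, T (u - p)⟫_ℂ = 0 := by
  have hmem := (V.map T).starProjection_apply_mem (T u)
  obtain ⟨p, hp, hpu⟩ := hmem
  refine ⟨p, ⟨hp, fun v hv => ?_⟩, ?_⟩
  · rw [map_sub, hpu, ← inner_conj_symm,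
      Submodule.starProjection_inner_eq_zero _ _ (Submodule.mem_map_of_mem hv), map_zero]
  · rintro q ⟨hq, hqu⟩
    refine hT (hpu.trans (Submodule.eq_starProjection_of_mem_of_inner_eq_zero
      (Submodule.mem_map_of_mem hq) ?_)).symm
    rintro _ ⟨v, hv, rfl⟩
    rw [← inner_conj_symm, ← map_sub, hqu v hv, map_zero]

/-- The duality step of the Aubin–Nitsche argument: a Galerkin error is tested only against best
approximation errors. -/
theorem norm_inner_le_iInf {F E : Type*} [AddCommGroup F] [Module ℂ F]
    [NormedAddCommGroup E] [InnerProductSpace ℂ E] {D V : Submodule ℂ F} (hV : V ≤ D)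
    (T : D →ₗ[ℂ] E) {N : F → ℝ} {K : ℝ} (hK : 0 ≤ K) (hN : ∀ v, 0 ≤ N v)
    (hT : ∀ v : D, ‖T v‖ ≤ K * N v) {e : D}
    (he : ∀ (v : F) (hv : v ∈ V), ⟪T ⟨v, hV hv⟩, T e⟫_ℂ = 0) (φ : D) :
    ‖⟪T e, T φ⟫_ℂ‖ ≤ K * N e * (K * ⨅ v : V, N (φ - (v : F))) := by
  -- With the constants inside the infimum, it is enough to bound by each competitor `v`;
  -- orthogonality then allows `φ` to be replaced by `φ - v`.
  rw [Real.mul_iInf_of_nonneg hK, Real.mul_iInf_of_nonneg (mul_nonneg hK (hN _))]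
  refine le_ciInf fun v => ?_
  have h1 : ⟪T e, T φ⟫_ℂ = ⟪T e, T (φ - ⟨v, hV v.2⟩)⟫_ℂ := by
    rw [map_sub, inner_sub_right, ← inner_conj_symm (T e) (T ⟨v, hV v.2⟩), he v v.2, map_zero,
      sub_zero]
  rw [h1]
  refine (norm_inner_le_norm _ _).trans ?_
  exact mul_le_mul (hT e) (hT _) (norm_nonneg _) (mul_nonneg hK (hN _))

/-! ### The Ritz projection -/

theorem existsUnique_isRitzProj {Ω : Set Plane} (hΩ : IsOpen Ω) (hb : Bornology.IsBounded Ω)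
    {n : Plane → ℝ} (hn : IsIndex Ω n) {X Y : Submodule ℂ (L2 Ω)} (hX : X ≤ H0 2 Ω)
    (hY : Y ≤ H0 1 Ω) [FiniteDimensional ℂ X] [FiniteDimensional ℂ Y] {u w : L2 Ω}
    (hu : u ∈ H0 2 Ω) (hw : w ∈ H0 1 Ω) : ∃! p, IsRitzProj n X Y (u, w) p := by
  -- The discrete spaces live in `L²(Ω)`, but the operators are defined only on `H₀^k(Ω)`, so they
  -- are pulled back along the inclusions.
  have : FiniteDimensional ℂ (X.comap (H0 2 Ω).subtype) :=
    (Submodule.comapSubtypeEquivOfLe hX).symm.finiteDimensional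
  have : FiniteDimensional ℂ (Y.comap (H0 1 Ω).subtype) :=
    (Submodule.comapSubtypeEquivOfLe hY).symm.finiteDimensional
  obtain ⟨p, ⟨hp, hpo⟩, hpu⟩ := existsUnique_galerkin (X.comap (H0 2 Ω).subtype)
    (weightedLapₗ_injective hΩ hb hn) ⟨u, hu⟩
  obtain ⟨q, ⟨hq, hqo⟩, hqu⟩ := existsUnique_galerkin (Y.comap (H0 1 Ω).subtype)
    (gradₗ_injective hΩ hb) ⟨w, hw⟩
  refine ⟨(p, q), ⟨hp, hq, fun v hv => ?_, fun z hz => ?_⟩, ?_⟩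
  · have horth := hpo ⟨v, hX hv⟩ hv
    rwa [inner_weightedLapₗ, Submodule.coe_sub] at horth
  · have horth := hqo ⟨z, hY hz⟩ hz
    rwa [inner_gradₗ, Submodule.coe_sub] at horth
  · rintro ⟨p', q'⟩ ⟨h1, h2, h3, h4⟩
    have e1 := hpu ⟨p', hX h1⟩ ⟨h1, fun v hv => by
      rw [inner_weightedLapₗ, Submodule.coe_sub]
      exact h3 v hv⟩
    have e2 := hqu ⟨q', hY h2⟩ ⟨h2, fun z hz => by
      rw [inner_gradₗ, Submodule.coe_sub]
      exact h4 z hz⟩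
    exact Prod.ext (congrArg Subtype.val e1) (congrArg Subtype.val e2)

/-! ### The `H¹` inner product with a fixed function as an element of `H⁻¹(Ω)` -/

/-- The functional `v ↦ (e, v)_{H¹(Ω)}` on `H₀¹(Ω)`. -/
noncomputable def hOneDual {Ω : Set Plane} (hΩ : IsOpen Ω) (e : L2 Ω) :
    H0 1 Ω →ₛₗ[starRingEnd ℂ] ℂ where
  toFun v := ⟪(v : L2 Ω), e⟫_ℂ + ⟪weakDₗ hΩ (1, 0) le_rfl v, weakD (1, 0) e⟫_ℂ
    + ⟪weakDₗ hΩ (0, 1) le_rfl v, weakD (0, 1) e⟫_ℂ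
  map_add' u v := by
    simp only [map_add, Submodule.coe_add, inner_add_left]
    ring
  map_smul' c u := by
    simp only [map_smul, Submodule.coe_smul, inner_smul_left, smul_eq_mul]
    ring

/-- Cauchy–Schwarz on each of the three summands; the crude factor 3 only affects the final
constant. -/
theorem norm_hOneDual_le {Ω : Set Plane} (hΩ : IsOpen Ω) (e : L2 Ω) (v : H0 1 Ω) :
    ‖hOneDual hΩ e v‖ ≤ 3 * hNorm 1 e * hNorm 1 (v : L2 Ω) := by
  have hb : ∀ a b : L2 Ω, ‖a‖ ≤ hNorm 1 (v : L2 Ω) → ‖b‖ ≤ hNorm 1 e →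
      ‖⟪a, b⟫_ℂ‖ ≤ hNorm 1 (v : L2 Ω) * hNorm 1 e := fun a b ha hb' =>
    (norm_inner_le_norm _ _).trans (mul_le_mul ha hb' (norm_nonneg _) (hNorm_nonneg _ _))
  have h0 : ∀ u : L2 Ω, ‖u‖ ≤ hNorm 1 u := fun u =>
    (hNorm_zero hΩ u).symm.le.trans (hNorm_mono zero_le_one u)
  have h1 := hb _ _ (h0 v) (h0 e)
  have h2 := hb _ _ (norm_weakD_le_hNorm (α := (1, 0)) le_rfl _)
    (norm_weakD_le_hNorm (α := (1, 0)) le_rfl _)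
  have h3 := hb _ _ (norm_weakD_le_hNorm (α := (0, 1)) le_rfl _)
    (norm_weakD_le_hNorm (α := (0, 1)) le_rfl _)
  refine norm_add₃_le.trans ?_
  simp only [weakDₗ_apply]
  linarith

theorem memHneg_hOneDual {Ω : Set Plane} (hΩ : IsOpen Ω) (e : L2 Ω) :
    MemHneg (hOneDual hΩ e) :=
  ⟨_, norm_hOneDual_le hΩ e⟩

theorem hnegNorm_nonneg {Ω : Set Plane} (ξ : H0 1 Ω →ₛₗ[starRingEnd ℂ] ℂ) : 0 ≤ hnegNorm ξ :=
  Real.iSup_nonneg fun _ => div_nonneg (norm_nonneg _) (hNorm_nonneg _ _)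

theorem hnegNorm_hOneDual_le {Ω : Set Plane} (hΩ : IsOpen Ω) (e : L2 Ω) :
    hnegNorm (hOneDual hΩ e) ≤ 3 * hNorm 1 e :=
  -- Only nonnegativity of the denominator is required here, so the quotient `0 / 0` at `v = 0` is
  -- covered.
  ciSup_le fun v => div_le_of_le_mul₀ (hNorm_nonneg _ _)
    (mul_nonneg zero_le_three (hNorm_nonneg _ _)) (norm_hOneDual_le hΩ e v)

/-- This is why the functional is chosen as dual datum: testing the dual problem with the error
produces the squared norm to be estimated. -/
theorem norm_hOneDual_self {Ω : Set Plane} (hΩ : IsOpen Ω) (e : H0 1 Ω) :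
    ‖hOneDual hΩ (e : L2 Ω) e‖ = hNorm 1 (e : L2 Ω) ^ 2 := by
  have h : hOneDual hΩ (e : L2 Ω) e = ((hNorm 1 (e : L2 Ω) ^ 2 : ℝ) : ℂ) := by
    rw [hNorm_one_sq hΩ]
    push_cast
    change ⟪(e : L2 Ω), e⟫_ℂ + ⟪weakD (1, 0) (e : L2 Ω), weakD (1, 0) (e : L2 Ω)⟫_ℂ
      + ⟪weakD (0, 1) (e : L2 Ω), weakD (0, 1) (e : L2 Ω)⟫_ℂ = _
    simp only [inner_self_eq_norm_sq_to_K]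
    rfl
  rw [h, Complex.norm_real, Real.norm_of_nonneg (sq_nonneg _)]

/-! ### The Aubin–Nitsche estimates -/

/-- Cancels a factor `x` without a separate case for a vanishing error. -/
theorem le_of_sq_le_mul {x a : ℝ} (ha : 0 ≤ a) (h : x ^ 2 ≤ a * x) : x ≤ a := by
  by_contra! hlt
  nlinarith [mul_lt_mul_of_pos_right hlt (ha.trans_lt hlt)]

/-- If a squared error norm `x²` is bounded by `K E` times `K` times a best approximation error
`d ≤ C H s` and the dual solution has norm `s ≤ A y` with `y ≤ M x`, then `x ≲ H E`. -/
theorem le_of_duality {x K E d C H s A y M : ℝ} (hK : 0 ≤ K) (hE : 0 ≤ E) (hH : 0 ≤ H)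
    (hs : 0 ≤ s) (hy : 0 ≤ y) (hM : 0 ≤ M) (hx : x ^ 2 ≤ K * E * (K * d)) (hd : d ≤ C * H * s)
    (hsA : s ≤ A * y) (hyM : y ≤ M * x) : x ≤ (K * K * |C| * |A| * M) * H * E := by
  have h1 : s ≤ |A| * (M * x) := hsA.trans
    ((mul_le_mul_of_nonneg_right (le_abs_self A) hy).trans
      (mul_le_mul_of_nonneg_left hyM (abs_nonneg A)))
  have h2 : d ≤ |C| * H * (|A| * (M * x)) := hd.trans
    ((mul_le_mul_of_nonneg_right (mul_le_mul_of_nonneg_right (le_abs_self C) hH) hs).trans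
      (mul_le_mul_of_nonneg_left h1 (mul_nonneg (abs_nonneg C) hH)))
  refine le_of_sq_le_mul (by positivity) (hx.trans ?_)
  calc K * E * (K * d) ≤ K * E * (K * (|C| * H * (|A| * (M * x)))) := by gcongr
    _ = _ := by ring

theorem exists_hNorm_one_le_of_orthogonal {Ω : Set Plane} (hΩ : IsOpen Ω) {n : Plane → ℝ}
    (hn : IsIndex Ω n) {ι : Type*} {h : ι → ℝ} (h_pos : ∀ i, 0 < h i)
    {X Y : ι → Submodule ℂ (L2 Ω)} (hX : ∀ i, X i ≤ H0 2 Ω) {k : ℕ} {r : ℝ} (hr : 0 < r)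
    (hr' : r ≤ 1) (hC2 : CondC2 h X Y k) (hA1 : CondA1 Ω n r) :
    ∃ C ≥ 0, ∀ i, ∀ e ∈ H0 2 Ω, (∀ v ∈ X i, weightedForm n (lap e) (lap v) = 0) →
      hNorm 1 e ≤ C * h i ^ r * hNorm 2 e := by
  obtain ⟨A, hA⟩ := hA1
  -- The dual solution is approximated in the energy norm `s = 2` with smoothness `σ = r`, so the
  -- power of `h` is `2 + r - 2 = r`.
  obtain ⟨C, hC⟩ := hC2.fst r hr (hr'.trans one_le_two) 2 (Or.inr rfl)
  obtain ⟨K, hK, hKT⟩ := exists_norm_weightedLapₗ_le hΩ hn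
  refine ⟨K * K * |C| * |A| * 3, by positivity, fun i e he horth => ?_⟩
  obtain ⟨ψ, hψ, hψs, hweak, hle⟩ := hA (hOneDual hΩ e) (memHneg_hOneDual hΩ e)
  have h1 := norm_inner_le_iInf (hX i) (weightedLapₗ hΩ hn) hK (hNorm_nonneg 2) hKT
    (e := ⟨e, he⟩) (fun v hv => (inner_weightedLapₗ hΩ hn _ _).trans (horth v hv)) ⟨ψ, hψ⟩
  -- The weak form of the dual problem, tested with `e`, turns the left side into `‖e‖₁²`.
  rw [inner_weightedLapₗ, hweak e he, norm_hOneDual_self hΩ ⟨e, H0_anti one_le_two Ω he⟩] at h1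
  have h2 := hC i ψ hψ hψs
  rw [Nat.cast_ofNat, add_sub_cancel_left] at h2
  exact le_of_duality hK (hNorm_nonneg _ _) (Real.rpow_nonneg (h_pos i).le _)
    (hsNorm_nonneg _ _) (hnegNorm_nonneg _) zero_le_three h1 h2 hle (hnegNorm_hOneDual_le hΩ e)

theorem exists_hNorm_zero_le_of_orthogonal {Ω : Set Plane} (hΩ : IsOpen Ω) {ι : Type*}
    {h : ι → ℝ} (h_pos : ∀ i, 0 < h i) {X Y : ι → Submodule ℂ (L2 Ω)}
    (hY : ∀ i, Y i ≤ H0 1 Ω) {k : ℕ} {r : ℝ} (hr : 0 < r) (hr' : r ≤ k)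
    (hC2 : CondC2 h X Y k) (hA2 : CondA2 Ω r) :
    ∃ C ≥ 0, ∀ i, ∀ e ∈ H0 1 Ω, (∀ z ∈ Y i, gradForm e z = 0) →
      hNorm 0 e ≤ C * h i ^ r * hNorm 1 e := by
  obtain ⟨A, hA⟩ := hA2
  obtain ⟨C, hC⟩ := hC2.snd r hr hr' 1 (Or.inr rfl)
  refine ⟨1 * 1 * |C| * |A| * 1, by positivity, fun i e he horth => ?_⟩
  obtain ⟨φ, hφ, hφs, hweak, hle⟩ := hA e
  have h1 := norm_inner_le_iInf (hY i) (gradₗ hΩ) zero_le_one (hNorm_nonneg 1)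
    (fun v => (norm_gradₗ_le hΩ v).trans (one_mul _).ge) (e := ⟨e, he⟩)
    (fun z hz => (inner_gradₗ hΩ _ _).trans (horth z hz)) ⟨φ, hφ⟩
  -- The minus sign in the weak form of `Δφ = e` disappears under the norm, which leaves `‖e‖₀²`.
  rw [inner_gradₗ, ← norm_neg, hweak e he, ← inner_eq_l2Form, ← inner_self_re_eq_norm,
    ← norm_sq_eq_re_inner] at h1
  have h2 := hC i φ hφ hφs
  rw [Nat.cast_one, add_sub_cancel_left] at h2
  rw [hNorm_zero hΩ]
  exact le_of_duality zero_le_one (hNorm_nonneg _ _) (Real.rpow_nonneg (h_pos i).le _)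
    (hsNorm_nonneg _ _) (norm_nonneg _) zero_le_one h1 h2 hle (one_mul _).ge

/-- An estimate of order `r` is one of every smaller order `s`, also for `h > 1`, if `x ≤ y`. -/
theorem le_mul_rpow_of_le {x y C h r s : ℝ} (hC : 0 ≤ C) (hh : 0 < h) (hs : 0 ≤ s)
    (hsr : s ≤ r) (hy : 0 ≤ y) (hxy : x ≤ y) (hle : x ≤ C * h ^ r * y) :
    x ≤ (C + 1) * h ^ s * y := by
  rcases le_total h 1 with h1 | h1
  · refine hle.trans (mul_le_mul_of_nonneg_right ?_ hy)
    exact mul_le_mul (by linarith) (Real.rpow_le_rpow_of_exponent_ge hh h1 hsr)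
      (Real.rpow_nonneg hh.le _) (by linarith)
  -- Here `h ^ s ≥ 1`, and the added 1 in `C + 1` makes the whole factor at least 1.
  · refine hxy.trans (le_mul_of_one_le_left hy ?_)
    exact one_le_mul_of_one_le_of_one_le (by linarith) (Real.one_le_rpow h1 hs)

end Transmission

open Transmission in
theorem lemma3p4 {Ω : Set Transmission.Plane} (hΩ : Transmission.IsBoundedLipschitzDomain Ω)
    {n : Transmission.Plane → ℝ} (hn : Transmission.IsIndex Ω n)
    {ι : Type*} (h : ι → ℝ) (h_pos : ∀ i, 0 < h i)
    (X Y : ι → Submodule ℂ (Transmission.L2 Ω))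
    (hX : ∀ i, X i ≤ Transmission.H0 2 Ω) (hY : ∀ i, Y i ≤ Transmission.H0 1 Ω)
    (hX_fin : ∀ i, FiniteDimensional ℂ (X i)) (hY_fin : ∀ i, FiniteDimensional ℂ (Y i))
    (k : ℕ) (hk : k = 1 ∨ k = 2)
    (r₁ r₂ : ℝ) (hr₁ : 0 < r₁ ∧ r₁ ≤ 1) (hr₂ : 0 < r₂ ∧ r₂ ≤ 1)
    (hC1 : Transmission.CondC1 h X Y) (hC2 : Transmission.CondC2 h X Y k)
    (hA1 : Transmission.CondA1 Ω n r₁) (hA2 : Transmission.CondA2 Ω r₂) :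
    (∀ i, ∀ u ∈ Transmission.H0 2 Ω, ∀ w ∈ Transmission.H0 1 Ω,
      ∃! p, Transmission.IsRitzProj n (X i) (Y i) (u, w) p) ∧
    ∃ C > 0, ∀ i, ∀ u ∈ Transmission.H0 2 Ω, ∀ w ∈ Transmission.H0 1 Ω,
      ∀ p, Transmission.IsRitzProj n (X i) (Y i) (u, w) p →
        Transmission.normH1 ((u, w) - p) ≤
          C * h i ^ min r₁ r₂ * Transmission.normH ((u, w) - p) := by
  have hk1 : (1 : ℝ) ≤ k := by
    rcases hk with rfl | rfl <;> norm_num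
  refine ⟨fun i u hu w hw => ?_, ?_⟩
  · have := hX_fin i
    have := hY_fin i
    exact existsUnique_isRitzProj hΩ.isOpen hΩ.isBounded hn (hX i) (hY i) hu hw
  obtain ⟨C₁, hC₁, h₁⟩ := exists_hNorm_one_le_of_orthogonal hΩ.isOpen hn h_pos hX hr₁.1 hr₁.2
    hC2 hA1
  obtain ⟨C₂, hC₂, h₂⟩ := exists_hNorm_zero_le_of_orthogonal hΩ.isOpen h_pos hY hr₂.1
    (hr₂.2.trans hk1) hC2 hA2
  have hmin : 0 ≤ min r₁ r₂ := le_min hr₁.1.le hr₂.1.le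
  refine ⟨(C₁ + 1) + (C₂ + 1), by positivity, fun i u hu w hw p hp => ?_⟩
  have e₁ := le_mul_rpow_of_le hC₁ (h_pos i) hmin (min_le_left r₁ r₂) (hNorm_nonneg 2 (u - p.1))
    (hNorm_mono one_le_two _) (h₁ i _ (sub_mem hu (hX i hp.fst_mem)) hp.fst_orth)
  have e₂ := le_mul_rpow_of_le hC₂ (h_pos i) hmin (min_le_right r₁ r₂) (hNorm_nonneg 1 (w - p.2))
    (hNorm_mono zero_le_one _) (h₂ i _ (sub_mem hw (hY i hp.snd_mem)) hp.snd_orth)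
  have hh : 0 ≤ h i ^ min r₁ r₂ := Real.rpow_nonneg (h_pos i).le _
  -- With the sum of the two constants in front, expanding the product leaves two mixed terms; they
  -- are nonnegative and can be dropped.
  have n₁ := mul_nonneg (mul_nonneg (add_nonneg hC₂ zero_le_one) hh) (hNorm_nonneg 2 (u - p.1))
  have n₂ := mul_nonneg (mul_nonneg (add_nonneg hC₁ zero_le_one) hh) (hNorm_nonneg 1 (w - p.2))
  change hNorm 1 (u - p.1) + hNorm 0 (w - p.2) ≤
    (C₁ + 1 + (C₂ + 1)) * h i ^ min r₁ r₂ * (hNorm 2 (u - p.1) + hNorm 1 (w - p.2))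
  linarith
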